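/- Let $d\ge 1$. For $z=(x,\omega)\in\mathbb{R}^{d}\times\mathbb{R}^{d}=\mathbb{R}^{2d}$ let $\pi(z)$ be the time-frequency shift $\pi(z)\psi(t)=e^{2\pi i\omega\cdot t}\psi(t-x)$ on $L^2(\mathbb{R}^d)$, let $P\psi(t)=\psi(-t)$, and for a bounded operator $A$ on $L^2(\mathbb{R}^d)$ put $\alpha_z(A)=\pi(z)A\pi(z)^*$ and $\check A=PAP$. For trace class operators $A,B$ let $A\star B(z)=\mathrm{tr}(A\,\alpha_z(\check B))$, and for $f\in L^1(\mathbb{R}^{2d})$ let $f\star A=\int_{\mathbb{R}^{2d}}f(z)\,\alpha_z(A)\,dz$ (weak integral). Let $S$ be a density operator on $L^2(\mathbb{R}^d)$, i.e. a positive trace class operator with $\mathrm{tr}(S)=1$, and put $Q_S(\psi)=\check S\star(\psi\otimes\psi)$ for $\psi\in L^2(\mathbb{R}^d)$, where $(\psi\otimes\psi)\xi=\langle\xi,\psi\rangle\psi$. Let $\Omega\subset\mathbb{R}^{2d}$ be compact, with characteristic function $\chi_\Omega$. For every $R>0$ let $R\Omega=\{Rz:z\in\Omega\}$ and let $$\chi_{R\Omega}\star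 S=\sum_{k=1}^\infty\lambda_k^{R\Omega}\,h_k^{R\Omega}\otimes h_k^{R\Omega}$$ be any spectral representation (convergent in operator norm) of the positive trace class operator $\chi_{R\Omega}\star S$, with real eigenvalues in decreasing order $\lambda_1^{R\Omega}\ge\lambda_2^{R\Omega}\ge\cdots$ and orthonormal eigenfunctions $(h_k^{R\Omega})_{k\ge1}$. Define the accumulated Cohen class distribution $$\rho^S_{R\Omega}(z)=\sum_{k=1}^{\lceil|R\Omega|\rceil}Q_S(h_k^{R\Omega})(z),\qquad z\in\mathbb{R}^{2d},$$ where $|R\Omega|$ is the Lebesgue measure of $R\Omega$. Then $\rho^S_{R\Omega}(R\,\cdot)\in L^1(\mathbb{R}^{2d})$ for every $R>0$, and $$\|\rho^S_{R\Omega}(R\,\cdot)-\chi_\Omega\|_{L^1(\mathbb{R}^{2d})}\to0\quad\text{as }R\to\infty.$$ -/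

import Mathlib

open MeasureTheory Filter Topology
open scoped Pointwise ENNReal

noncomputable section

namespace QHA

/-! ### Configuration space, phase space and the Hilbert space `L²(ℝᵈ)` -/

/-- The configuration space `ℝᵈ`. -/
abbrev Conf (d : ℕ) : Type := EuclideanSpace ℝ (Fin d)

/-- The phase space `ℝ²ᵈ`, whose points are written `z = (x, ω)`; its `volume` is Lebesgue
measure. -/
abbrev Phase (d : ℕ) : Type := Conf d × Conf d

/-- The Hilbert space `L²(ℝᵈ)` of complex valued functions. -/
abbrev L2 (d : ℕ) : Type := Lp ℂ 2 (volume : Measure (Conf d))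

/-- The character `t ↦ e^{2πi ω·t}`. -/
def expChar {d : ℕ} (ω t : Conf d) : ℂ :=
  Complex.exp (2 * Real.pi * Complex.I * (inner ℝ ω t : ℝ))

theorem norm_expChar {d : ℕ} (ω t : Conf d) : ‖expChar ω t‖ = 1 := by
  have h : (2 * Real.pi * Complex.I * (inner ℝ ω t : ℝ) : ℂ)
      = ((2 * Real.pi * inner ℝ ω t : ℝ) : ℂ) * Complex.I := by
    push_cast; ring
  rw [expChar, h, Complex.norm_exp_ofReal_mul_I]

theorem expChar_neg_mul {d : ℕ} (ω t : Conf d) : expChar ω t * expChar (-ω) t = 1 := by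
  rw [expChar, expChar, ← Complex.exp_add, inner_neg_left]
  push_cast
  simp

theorem continuous_expChar {d : ℕ} : Continuous fun p : Conf d × Conf d => expChar p.1 p.2 := by
  unfold expChar
  fun_prop

theorem continuous_expChar_right {d : ℕ} (ω : Conf d) : Continuous (expChar ω) := by
  unfold expChar
  fun_prop

theorem continuous_expChar_left {d : ℕ} (t : Conf d) : Continuous fun ω => expChar ω t := by
  unfold expChar
  fun_prop

/-! ### Time-frequency shifts and parity -/

/-- The translation operator `T_x ψ(t) = ψ(t - x)` on `L²(ℝᵈ)`. -/
def translation {d : ℕ} (x : Conf d) : L2 d →ₗᵢ[ℂ] L2 d :=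
  Lp.compMeasurePreservingₗᵢ ℂ (fun t => t - x) (measurePreserving_sub_right volume x)

theorem translation_coe {d : ℕ} (x : Conf d) (ψ : L2 d) :
    translation x ψ =ᵐ[volume] fun t => ψ (t - x) :=
  Lp.coeFn_compMeasurePreserving ψ (measurePreserving_sub_right volume x)

theorem memLp_modulation {d : ℕ} (ω : Conf d) (ψ : L2 d) :
    MemLp (fun t => expChar ω t * ψ t) 2 volume := by
  refine (Lp.memLp ψ).of_le
    ((continuous_expChar_right ω).aestronglyMeasurable.mul (Lp.aestronglyMeasurable ψ)) ?_
  filter_upwards with t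
  rw [norm_mul, norm_expChar, one_mul]

/-- The modulation operator `M_ω ψ(t) = e^{2πi ω·t} ψ(t)` on `L²(ℝᵈ)`. -/
def modulation {d : ℕ} (ω : Conf d) : L2 d →ₗᵢ[ℂ] L2 d where
  toFun ψ := (memLp_modulation ω ψ).toLp _
  map_add' ψ φ := by
    ext1
    filter_upwards [(memLp_modulation ω (ψ + φ)).coeFn_toLp, (memLp_modulation ω ψ).coeFn_toLp,
      (memLp_modulation ω φ).coeFn_toLp, Lp.coeFn_add ψ φ,
      Lp.coeFn_add ((memLp_modulation ω ψ).toLp _) ((memLp_modulation ω φ).toLp _)]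
      with t h1 h2 h3 h4 h5
    rw [h1, h5, Pi.add_apply, h2, h3, h4, Pi.add_apply, mul_add]
  map_smul' c ψ := by
    ext1
    filter_upwards [(memLp_modulation ω (c • ψ)).coeFn_toLp, (memLp_modulation ω ψ).coeFn_toLp,
      Lp.coeFn_smul c ψ, Lp.coeFn_smul c ((memLp_modulation ω ψ).toLp _)] with t h1 h2 h3 h4
    rw [h1, RingHom.id_apply, h4, Pi.smul_apply, h2, h3, Pi.smul_apply, smul_eq_mul, smul_eq_mul,
      mul_left_comm]
  norm_map' ψ := by
    change ‖(memLp_modulation ω ψ).toLp _‖ = ‖ψ‖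
    rw [Lp.norm_toLp, Lp.norm_def]
    congr 1
    refine eLpNorm_congr_norm_ae ?_
    filter_upwards with t
    rw [norm_mul, norm_expChar, one_mul]

theorem modulation_coe {d : ℕ} (ω : Conf d) (ψ : L2 d) :
    modulation ω ψ =ᵐ[volume] fun t => expChar ω t * ψ t :=
  (memLp_modulation ω ψ).coeFn_toLp

/-- The time-frequency shift `π(z) = M_ω T_x` by `z = (x, ω)`. -/
def timeFreqShift {d : ℕ} (z : Phase d) : L2 d →L[ℂ] L2 d :=
  ((modulation z.2).comp (translation z.1)).toContinuousLinearMap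

theorem timeFreqShift_coe {d : ℕ} (z : Phase d) (ψ : L2 d) :
    timeFreqShift z ψ =ᵐ[volume]
      fun t => Complex.exp (2 * Real.pi * Complex.I * (inner ℝ z.2 t : ℝ)) * ψ (t - z.1) := by
  filter_upwards [modulation_coe z.2 (translation z.1 ψ), translation_coe z.1 ψ] with t h1 h2
  exact h1.trans (by rw [h2, expChar])

/-- The parity operator `P ψ(t) = ψ(-t)` on `L²(ℝᵈ)`. -/
def parity (d : ℕ) : L2 d →L[ℂ] L2 d :=
  (Lp.compMeasurePreservingₗᵢ ℂ (fun t : Conf d => -t)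
    (Measure.measurePreserving_neg volume)).toContinuousLinearMap

theorem parity_coe {d : ℕ} (ψ : L2 d) : parity d ψ =ᵐ[volume] fun t => ψ (-t) :=
  Lp.coeFn_compMeasurePreserving ψ (Measure.measurePreserving_neg volume)

/-- The translation of an operator by a point of phase space, `α_z(A) = π(z) A π(z)*`. -/
def opTranslate {d : ℕ} (z : Phase d) (A : L2 d →L[ℂ] L2 d) : L2 d →L[ℂ] L2 d :=
  timeFreqShift z ∘L A ∘L ContinuousLinearMap.adjoint (timeFreqShift z)

/-- The involution `Ǎ = P A P` of an operator. -/
def opCheck {d : ℕ} (A : L2 d →L[ℂ] L2 d) : L2 d →L[ℂ] L2 d :=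
  parity d ∘L A ∘L parity d

/-! ### Strong continuity of the time-frequency shifts -/

theorem translation_neg {d : ℕ} (x : Conf d) (ψ : L2 d) :
    translation x (translation (-x) ψ) = ψ := by
  ext1
  have h := (measurePreserving_sub_right (volume : Measure (Conf d)) x).quasiMeasurePreserving.ae
    (translation_coe (-x) ψ)
  filter_upwards [translation_coe x (translation (-x) ψ), h] with t h1 h2
  rw [h1, h2]
  simp

theorem modulation_neg {d : ℕ} (ω : Conf d) (ψ : L2 d) :
    modulation ω (modulation (-ω) ψ) = ψ := by
  ext1
  filter_upwards [modulation_coe ω (modulation (-ω) ψ), modulation_coe (-ω) ψ] with t h1 h2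
  rw [h1, h2, ← mul_assoc, expChar_neg_mul, one_mul]

theorem adjoint_timeFreqShift_apply {d : ℕ} (z : Phase d) (ψ : L2 d) :
    ContinuousLinearMap.adjoint (timeFreqShift z) ψ
      = translation (-z.1) (modulation (-z.2) ψ) := by
  refine ext_inner_left ℂ fun φ => ?_
  rw [ContinuousLinearMap.adjoint_inner_right]
  have h : ψ = timeFreqShift z (translation (-z.1) (modulation (-z.2) ψ)) := by
    change ψ = modulation z.2 (translation z.1 (translation (-z.1) (modulation (-z.2) ψ)))
    rw [translation_neg, modulation_neg]
  conv_lhs => rw [h]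
  exact LinearIsometry.inner_map_map ((modulation z.2).comp (translation z.1)) _ _

theorem continuous_translation {d : ℕ} {X : Type*} [TopologicalSpace X] {f : X → Conf d}
    {g : X → L2 d} (hf : Continuous f) (hg : Continuous g) :
    Continuous fun a => translation (f a) (g a) := by
  let G : C(X × Conf d, Conf d) := ⟨fun p => p.2 - f p.1, by fun_prop⟩
  exact hg.compMeasurePreservingLp G.curry.continuous
    (fun a => measurePreserving_sub_right volume (f a)) (by simp)

theorem continuous_modulation_left {d : ℕ} (ψ : L2 d) :
    Continuous fun ω : Conf d => modulation ω ψ := by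
  rw [continuous_iff_continuousAt]
  intro ω₀
  have hin : Continuous fun ω : Conf d => inner ℂ (modulation ω₀ ψ) (modulation ω ψ) := by
    have heq : (fun ω : Conf d => inner ℂ (modulation ω₀ ψ) (modulation ω ψ))
        = fun ω => ∫ t, inner ℂ (expChar ω₀ t * ψ t) (expChar ω t * ψ t) := by
      funext ω
      rw [L2.inner_def]
      refine integral_congr_ae ?_
      filter_upwards [modulation_coe ω₀ ψ, modulation_coe ω ψ] with t h1 h2
      rw [h1, h2]
    rw [heq]
    refine continuous_of_dominated (bound := fun t => ‖ψ t‖ ^ 2) ?_ ?_ ?_ ?_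
    · intro ω
      exact (memLp_modulation ω₀ ψ).aestronglyMeasurable.inner
        (memLp_modulation ω ψ).aestronglyMeasurable
    · intro ω
      filter_upwards with t
      refine (norm_inner_le_norm _ _).trans ?_
      rw [norm_mul, norm_mul, norm_expChar, norm_expChar, one_mul, sq]
    · exact (memLp_two_iff_integrable_sq_norm (Lp.aestronglyMeasurable ψ)).1 (Lp.memLp ψ)
    · filter_upwards with t
      exact continuous_const.inner ((continuous_expChar_left t).mul continuous_const)
  have hsq : Tendsto (fun ω : Conf d => ‖modulation ω ψ - modulation ω₀ ψ‖ ^ 2) (𝓝 ω₀) (𝓝 0) := by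
    have h1 : (fun ω : Conf d => ‖modulation ω ψ - modulation ω₀ ψ‖ ^ 2)
        = fun ω => ‖ψ‖ ^ 2 - 2 * RCLike.re (inner ℂ (modulation ω₀ ψ) (modulation ω ψ))
            + ‖ψ‖ ^ 2 := by
      funext ω
      rw [@norm_sub_sq ℂ, LinearIsometry.norm_map, LinearIsometry.norm_map, inner_re_symm]
    have h2 : Continuous fun ω : Conf d =>
        ‖ψ‖ ^ 2 - 2 * RCLike.re (inner ℂ (modulation ω₀ ψ) (modulation ω ψ)) + ‖ψ‖ ^ 2 := by
      fun_prop
    rw [h1]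
    have h3 := h2.tendsto ω₀
    rw [inner_self_eq_norm_sq, LinearIsometry.norm_map] at h3
    convert h3 using 2
    ring
  rw [ContinuousAt, tendsto_iff_norm_sub_tendsto_zero]
  have h4 := hsq.sqrt
  simpa [Real.sqrt_sq (norm_nonneg _)] using h4

theorem continuous_adjoint_timeFreqShift {d : ℕ} (ψ : L2 d) :
    Continuous fun z : Phase d => ContinuousLinearMap.adjoint (timeFreqShift z) ψ := by
  simp_rw [adjoint_timeFreqShift_apply]
  exact continuous_translation continuous_fst.neg
    ((continuous_modulation_left ψ).comp continuous_snd.neg)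

theorem norm_adjoint_timeFreqShift_le {d : ℕ} (z : Phase d) (ψ : L2 d) :
    ‖ContinuousLinearMap.adjoint (timeFreqShift z) ψ‖ ≤ ‖ψ‖ := by
  rw [adjoint_timeFreqShift_apply, LinearIsometry.norm_map, LinearIsometry.norm_map]

theorem inner_opTranslate {d : ℕ} (z : Phase d) (A : L2 d →L[ℂ] L2 d) (ξ ψ : L2 d) :
    inner ℂ ξ (opTranslate z A ψ)
      = inner ℂ (ContinuousLinearMap.adjoint (timeFreqShift z) ξ)
          (A (ContinuousLinearMap.adjoint (timeFreqShift z) ψ)) := by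
  rw [ContinuousLinearMap.adjoint_inner_left]
  rfl

theorem continuous_inner_opTranslate {d : ℕ} (A : L2 d →L[ℂ] L2 d) (ξ ψ : L2 d) :
    Continuous fun z : Phase d => inner ℂ ξ (opTranslate z A ψ) := by
  simp_rw [inner_opTranslate]
  exact (continuous_adjoint_timeFreqShift ξ).inner
    (A.continuous.comp (continuous_adjoint_timeFreqShift ψ))

theorem norm_inner_opTranslate_le {d : ℕ} (z : Phase d) (A : L2 d →L[ℂ] L2 d) (ξ ψ : L2 d) :
    ‖inner ℂ ξ (opTranslate z A ψ)‖ ≤ ‖A‖ * ‖ξ‖ * ‖ψ‖ := by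
  rw [inner_opTranslate]
  calc _ ≤ ‖ContinuousLinearMap.adjoint (timeFreqShift z) ξ‖
          * ‖A (ContinuousLinearMap.adjoint (timeFreqShift z) ψ)‖ := norm_inner_le_norm _ _
    _ ≤ ‖ξ‖ * (‖A‖ * ‖ψ‖) := by
        refine mul_le_mul (norm_adjoint_timeFreqShift_le z ξ) ?_ (norm_nonneg _) (norm_nonneg _)
        exact (A.le_opNorm _).trans
          (mul_le_mul_of_nonneg_left (norm_adjoint_timeFreqShift_le z ψ) (norm_nonneg _))
    _ = ‖A‖ * ‖ξ‖ * ‖ψ‖ := by ring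

theorem integrable_inner_opTranslate {d : ℕ} {f : Phase d → ℂ} (hf : Integrable f)
    (A : L2 d →L[ℂ] L2 d) (ξ ψ : L2 d) :
    Integrable fun z => f z * inner ℂ ξ (opTranslate z A ψ) :=
  hf.mul_bdd (c := ‖A‖ * ‖ξ‖ * ‖ψ‖)
    (continuous_inner_opTranslate A ξ ψ).aestronglyMeasurable
    (Eventually.of_forall fun z => norm_inner_opTranslate_le z A ξ ψ)

/-! ### The convolution of a function with an operator -/

/-- `T` is the operator `∫ f(z) α_z(A) dz`, the integral being understood weakly:
`⟨Tψ, ξ⟩ = ∫ f(z) ⟨α_z(A)ψ, ξ⟩ dz` for all `ψ, ξ ∈ L²(ℝᵈ)`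
(Mathlib's inner product is linear in its second argument). -/
def IsFunOpConv {d : ℕ} (f : Phase d → ℂ) (A T : L2 d →L[ℂ] L2 d) : Prop :=
  ∀ ψ ξ : L2 d, inner ℂ ξ (T ψ) = ∫ z, f z * inner ℂ ξ (opTranslate z A ψ)

theorem IsFunOpConv.unique {d : ℕ} {f : Phase d → ℂ} {A T T' : L2 d →L[ℂ] L2 d}
    (h : IsFunOpConv f A T) (h' : IsFunOpConv f A T') : T = T' := by
  ext1 ψ
  exact ext_inner_left ℂ fun ξ => (h ψ ξ).trans (h' ψ ξ).symm

theorem exists_isFunOpConv {d : ℕ} {f : Phase d → ℂ} (hf : Integrable f)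
    (A : L2 d →L[ℂ] L2 d) : ∃ T, IsFunOpConv f A T := by
  let B : L2 d →ₗ⋆[ℂ] L2 d →ₗ[ℂ] ℂ := LinearMap.mk₂'ₛₗ (starRingEnd ℂ) (RingHom.id ℂ)
    (fun ξ ψ => ∫ z, f z * inner ℂ ξ (opTranslate z A ψ))
    (fun ξ ξ' ψ => by
      rw [← integral_add (integrable_inner_opTranslate hf A ξ ψ)
        (integrable_inner_opTranslate hf A ξ' ψ)]
      simp_rw [inner_add_left, mul_add])
    (fun c ξ ψ => by
      simp_rw [inner_smul_left, mul_left_comm (f _)]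
      rw [integral_const_mul, smul_eq_mul])
    (fun ξ ψ ψ' => by
      rw [← integral_add (integrable_inner_opTranslate hf A ξ ψ)
        (integrable_inner_opTranslate hf A ξ ψ')]
      simp_rw [map_add, inner_add_right, mul_add])
    (fun c ξ ψ => by
      simp_rw [map_smul, inner_smul_right, mul_left_comm (f _)]
      rw [integral_const_mul, RingHom.id_apply, smul_eq_mul])
  have hB : ∀ ξ ψ, ‖B ξ ψ‖ ≤ ((∫ z, ‖f z‖) * ‖A‖) * ‖ξ‖ * ‖ψ‖ := by
    intro ξ ψ
    change ‖∫ z, f z * inner ℂ ξ (opTranslate z A ψ)‖ ≤ _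
    calc _ ≤ ∫ z, ‖f z‖ * (‖A‖ * ‖ξ‖ * ‖ψ‖) := by
          refine norm_integral_le_of_norm_le (hf.norm.mul_const _) (Eventually.of_forall fun z => ?_)
          rw [norm_mul]
          exact mul_le_mul_of_nonneg_left (norm_inner_opTranslate_le z A ξ ψ) (norm_nonneg _)
      _ = _ := by rw [integral_mul_const]; ring
  let B' : L2 d →L⋆[ℂ] L2 d →L[ℂ] ℂ := LinearMap.mkContinuous₂ B _ hB
  refine ⟨ContinuousLinearMap.adjoint (InnerProductSpace.continuousLinearMapOfBilin B'),
    fun ψ ξ => ?_⟩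
  rw [ContinuousLinearMap.adjoint_inner_right, InnerProductSpace.continuousLinearMapOfBilin_apply]
  rfl

/-- The convolution `f ⋆ A = ∫ f(z) α_z(A) dz` of an integrable function on phase space with an
operator (weak integral; `0` by convention if `f` is not integrable). -/
def funOpConv {d : ℕ} (f : Phase d → ℂ) (A : L2 d →L[ℂ] L2 d) : L2 d →L[ℂ] L2 d :=
  open Classical in if hf : Integrable f then (exists_isFunOpConv hf A).choose else 0

theorem funOpConv_spec {d : ℕ} {f : Phase d → ℂ} (hf : Integrable f) (A : L2 d →L[ℂ] L2 d) :
    IsFunOpConv f A (funOpConv f A) := by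
  rw [funOpConv, dif_pos hf]
  exact (exists_isFunOpConv hf A).choose_spec

/-- The characteristic function of a subset of phase space. -/
def charFun {d : ℕ} (Ω : Set (Phase d)) : Phase d → ℂ := Ω.indicator fun _ => 1

theorem integrable_charFun {d : ℕ} {Ω : Set (Phase d)} (hΩ : IsCompact Ω) :
    Integrable (charFun Ω) :=
  (integrable_indicator_iff hΩ.measurableSet).2 (integrableOn_const hΩ.measure_lt_top.ne)

/-- The mixed-state localization operator `χ_Ω ⋆ S`. -/
def locOp {d : ℕ} (S : L2 d →L[ℂ] L2 d) (Ω : Set (Phase d)) : L2 d →L[ℂ] L2 d :=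
  funOpConv (charFun Ω) S

/-! ### Trace, density operators and the convolution of two operators -/

/-- The index set of a fixed orthonormal basis of `L²(ℝᵈ)`. -/
def basisIndex (d : ℕ) : Set (L2 d) := (exists_hilbertBasis ℂ (L2 d)).choose

/-- A fixed orthonormal basis of `L²(ℝᵈ)`. -/
def basis (d : ℕ) : HilbertBasis (basisIndex d) ℂ (L2 d) :=
  (exists_hilbertBasis ℂ (L2 d)).choose_spec.choose

/-- The trace `tr(A) = ∑ₖ ⟨A eₖ, eₖ⟩`; for trace class `A` the sum converges absolutely and does
not depend on the orthonormal basis. -/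
def opTrace {d : ℕ} (A : L2 d →L[ℂ] L2 d) : ℂ :=
  ∑' i, inner ℂ (basis d i) (A (basis d i))

/-- The absolute value `|A| = (A* A)^{1/2}` of an operator on a Hilbert space. -/
def opAbs {H : Type*} [NormedAddCommGroup H] [InnerProductSpace ℂ H] [CompleteSpace H]
    (A : H →L[ℂ] H) : H →L[ℂ] H :=
  CFC.abs A

/-- `A` is a trace class operator: it is compact and `tr |A| < ∞`. -/
def IsTraceClass {d : ℕ} (A : L2 d →L[ℂ] L2 d) : Prop :=
  IsCompactOperator A ∧ Summable fun i => inner ℂ (basis d i) (opAbs A (basis d i))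

/-- A density operator is a positive trace class operator with trace one. -/
structure IsDensityOperator {d : ℕ} (S : L2 d →L[ℂ] L2 d) : Prop where
  isPositive : S.IsPositive
  isTraceClass : IsTraceClass S
  trace_eq_one : opTrace S = 1

/-- The convolution `A ⋆ B (z) = tr(A α_z(B̌))` of two trace class operators, a function on phase
space. -/
def opConv {d : ℕ} (A B : L2 d →L[ℂ] L2 d) (z : Phase d) : ℂ :=
  opTrace (A ∘L opTranslate z (opCheck B))

/-- The Cohen class distribution `Q_S(ψ) = Š ⋆ (ψ ⊗ ψ)`, where `(ψ ⊗ ψ) ξ = ⟨ξ, ψ⟩ ψ`. -/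
def cohen {d : ℕ} (S : L2 d →L[ℂ] L2 d) (ψ : L2 d) : Phase d → ℂ :=
  opConv (opCheck S) (InnerProductSpace.rankOne ℂ ψ ψ)

/-! ### Spectral representation and the accumulated Cohen class distribution -/

/-- `A = ∑ₖ λₖ hₖ ⊗ hₖ` (convergence in operator norm) is a spectral representation of `A` with
eigenvalues `λ₀ ≥ λ₁ ≥ ⋯` in decreasing order and orthonormal eigenfunctions `h₀, h₁, …`. -/
structure IsSpectralRep {d : ℕ} (A : L2 d →L[ℂ] L2 d) (lam : ℕ → ℝ) (h : ℕ → L2 d) : Prop where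
  antitone : Antitone lam
  orthonormal : Orthonormal ℂ h
  hasSum : HasSum (fun k => (lam k : ℂ) • InnerProductSpace.rankOne ℂ (h k) (h k)) A

/-- The accumulated Cohen class distribution `∑_{k ≤ ⌈|Ω|⌉} Q_S(hₖ)` formed with the first
`⌈|Ω|⌉` members of the sequence `h` (to be used with the eigenfunctions of `χ_Ω ⋆ S`). -/
def accCohen {d : ℕ} (S : L2 d →L[ℂ] L2 d) (Ω : Set (Phase d)) (h : ℕ → L2 d) (z : Phase d) : ℂ :=
  ∑ k ∈ Finset.range ⌈volume.real Ω⌉₊, cohen S (h k) z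

end QHA

end

/-!
The idea is to compare the `L¹` error with `tr A - tr A²`, where `A = χ_{RΩ} ⋆ S`.

Write `S = ∑ᵢ fᵢ ⊗ fᵢ` with `fᵢ = S^{1/2} eᵢ` (`IsDensityOperator.exists_decomposition`). Then
`Q_S(ψ)(z) = ⟨α_z(S) ψ, ψ⟩ = ∑ᵢ |⟨π(z) fᵢ, ψ⟩|²` (`cohen_eq_toReal_cohenDensity`), and Moyal's
identity (`lintegral_enorm_inner_timeFreqShift_sq`) gives `∫ Q_S(ψ) = ‖ψ‖²`. As all quantities are
nonnegative, sums and integrals with values in `[0, ∞]` can be interchanged freely.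

Let `ρ` be the accumulated distribution of the first `N = ⌈|RΩ|⌉` eigenfunctions. By Bessel's
inequality `0 ≤ ρ ≤ 1`; moreover `∫ ρ = N`, and the integral of `ρ` over `RΩ` is `∑_{k < N} λₖ`
because `λₖ = ⟨A hₖ, hₖ⟩`. Since `∑ₖ λₖ = tr A = |RΩ|` (`tsum_eigenvalue`), the `L¹` distance of `ρ`
from the characteristic function of `RΩ` is `N - |RΩ|` plus twice the tail `∑_{k ≥ N} λₖ`. The tail
is at most `∑ₖ λₖ (1 - λₖ) = tr A - tr A²`, by the monotonicity of the eigenvalues and `|RΩ| ≤ N`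
(`le_sum_range_add`).

Finally `tr A²` is the double integral over `RΩ` of the autocorrelation `K(w - z)`, where
`K(u) = tr(S α_u(S)) ≥ 0` has integral `1`. Hence `tr A - tr A²` is the integral of `K(w - z)` over
`z ∈ RΩ`, `w ∉ RΩ` (`tsum_eigenvalue_sq_add_leakage`). Divided by `R²ᵈ` it becomes
`∫ K(u) |(u/R + Ω) \ Ω| du`, which tends to `0` by dominated convergence and the continuity of the
measure of translates of a compact set (`tendsto_leakage_smul`).
-/

namespace QHA

/-! ### Parseval and Plancherel -/

/-- Parseval's identity with values in `[0, ∞]`, where sums need no summability hypothesis. -/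
theorem _root_.HilbertBasis.tsum_enorm_inner_sq {ι E : Type*} [NormedAddCommGroup E]
    [InnerProductSpace ℂ E] (b : HilbertBasis ι ℂ E) (x : E) :
    ∑' i, ‖(inner ℂ (b i) x : ℂ)‖ₑ ^ 2 = ‖x‖ₑ ^ 2 := by
  have h := b.hasSum_inner_mul_inner x x
  have h2 : HasSum (fun i => ‖(inner ℂ (b i) x : ℂ)‖ ^ 2) (‖x‖ ^ 2) := by
    have h3 := Complex.reCLM.hasSum h
    simp only [Complex.reCLM_apply] at h3
    convert h3 using 1
    · ext i
      rw [← inner_conj_symm x (b i), ← Complex.normSq_eq_conj_mul_self]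
      simp [Complex.normSq_eq_norm_sq]
      norm_cast
    · exact (inner_self_eq_norm_sq (𝕜 := ℂ) x).symm
  have h4 := ENNReal.ofReal_tsum_of_nonneg (fun i => by positivity) h2.summable
  rw [h2.tsum_eq] at h4
  simp only [ENNReal.ofReal_pow (norm_nonneg _), ofReal_norm] at h4
  exact h4.symm

theorem _root_.Orthonormal.sum_enorm_inner_sq_le {ι E : Type*} [NormedAddCommGroup E]
    [InnerProductSpace ℂ E] {v : ι → E} (hv : Orthonormal ℂ v) (s : Finset ι) (x : E) :
    ∑ i ∈ s, ‖(inner ℂ (v i) x : ℂ)‖ₑ ^ 2 ≤ ‖x‖ₑ ^ 2 := by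
  have h := ENNReal.ofReal_le_ofReal (hv.sum_inner_products_le (x := x) (s := s))
  rw [ENNReal.ofReal_sum_of_nonneg (fun i _ => by positivity)] at h
  simpa only [ENNReal.ofReal_pow (norm_nonneg _), ofReal_norm] using h

theorem _root_.Orthonormal.countable {ι E : Type*} [NormedAddCommGroup E]
    [InnerProductSpace ℂ E] [SecondCountableTopology E] {v : ι → E} (hv : Orthonormal ℂ v) :
    Countable ι := by
  refine Pairwise.countable_of_isOpen_disjoint (s := fun i => Metric.ball (v i) (1 / 2)) ?_
    (fun i => Metric.isOpen_ball) (fun i => ⟨v i, by simp⟩)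
  intro i j hij
  refine Metric.ball_disjoint_ball ?_
  have h : ‖v i - v j‖ ^ 2 = 2 := by
    rw [@norm_sub_sq ℂ, hv.1 i, hv.1 j, hv.2 hij]
    norm_num
  rw [dist_eq_norm]
  nlinarith [norm_nonneg (v i - v j)]

open scoped FourierTransform SchwartzMap

section Plancherel

variable {V : Type*} [NormedAddCommGroup V] [InnerProductSpace ℝ V] [FiniteDimensional ℝ V]
  [MeasurableSpace V] [BorelSpace V]

/-- On `L¹ ∩ L²` the `L²` Fourier transform is given by the Fourier integral: both represent the
Fourier transform of the same tempered distribution. -/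
theorem fourier_toLp_ae_eq {g : V → ℂ} (hg : Integrable g) (hg2 : MemLp g 2) :
    (𝓕 (hg2.toLp g) : Lp ℂ 2 (volume : Measure V)) =ᵐ[volume] 𝓕 g := by
  have hcont : Continuous (𝓕 g) :=
    VectorFourier.fourierIntegral_continuous Real.continuous_fourierChar
      (by exact continuous_inner) hg
  refine ae_eq_of_integral_contDiff_smul_eq
    ((Lp.memLp _).locallyIntegrable (by norm_num)) hcont.locallyIntegrable ?_
  intro φ hφ hφc
  let φs : 𝓢(V, ℂ) := (hφc.comp_left (g := Complex.ofReal) rfl).toSchwartzMap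
    (Complex.ofRealCLM.contDiff.comp hφ)
  have h1 := congrArg (fun T => T φs) (Lp.fourier_toTemperedDistribution_eq (hg2.toLp g))
  simp only [TemperedDistribution.fourier_apply, Lp.toTemperedDistribution_apply] at h1
  have h2 := VectorFourier.integral_fourierIntegral_smul_eq_flip (L := innerₗ V)
    (μ := volume) (ν := volume) (f := (φs : V → ℂ)) (g := g)
    Real.continuous_fourierChar (by exact continuous_inner) φs.integrable hg
  have hflip : (innerₗ V).flip = innerₗ V := by
    ext x y
    exact real_inner_comm _ _
  rw [hflip] at h2
  have h3 : ∫ x, (𝓕 φs) x • g x = ∫ x, φs x • 𝓕 g x := by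
    rw [SchwartzMap.fourier_coe]
    exact h2
  have h4 : ∫ x, (𝓕 φs) x • (hg2.toLp g) x = ∫ x, (𝓕 φs) x • g x :=
    integral_congr_ae (by
      filter_upwards [hg2.coeFn_toLp] with x hx
      rw [hx])
  rw [h4, h3] at h1
  exact h1.symm

theorem lintegral_enorm_sq (u : Lp ℂ 2 (volume : Measure V)) : ∫⁻ t, ‖u t‖ₑ ^ 2 = ‖u‖ₑ ^ 2 := by
  rw [Lp.enorm_def, eLpNorm_eq_lintegral_rpow_enorm_toReal (by norm_num) (by norm_num)]
  simp [← ENNReal.rpow_mul_natCast]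

/-- Plancherel's theorem for the Fourier integral on `L¹ ∩ L²`. -/
theorem lintegral_enorm_fourier_sq {g : V → ℂ} (hg : Integrable g) (hg2 : MemLp g 2) :
    ∫⁻ w, ‖𝓕 g w‖ₑ ^ 2 = ∫⁻ t, ‖g t‖ₑ ^ 2 := by
  calc ∫⁻ w, ‖𝓕 g w‖ₑ ^ 2
      = ∫⁻ w, ‖(𝓕 (hg2.toLp g) : Lp ℂ 2 (volume : Measure V)) w‖ₑ ^ 2 :=
        lintegral_congr_ae (by
          filter_upwards [fourier_toLp_ae_eq hg hg2] with w hw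
          rw [hw])
    _ = ‖hg2.toLp g‖ₑ ^ 2 := by
        rw [lintegral_enorm_sq, ← ofReal_norm, Lp.norm_fourier_eq, ofReal_norm]
    _ = ∫⁻ t, ‖g t‖ₑ ^ 2 := by
        rw [← lintegral_enorm_sq]
        exact lintegral_congr_ae (by
          filter_upwards [hg2.coeFn_toLp] with w hw
          rw [hw])

end Plancherel

/-! ### Moyal's identity -/

/-- In the frequency variable, the short-time Fourier transform is the Fourier integral of a
product. -/
theorem inner_timeFreqShift_eq_fourier {d : ℕ} (z : Phase d) (f ψ : L2 d) :
    inner ℂ (timeFreqShift z f) ψ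
      = 𝓕 (fun t => inner ℂ (f (t - z.1)) (ψ t)) z.2 := by
  rw [L2.inner_def, Real.fourier_eq']
  refine integral_congr_ae ?_
  filter_upwards [timeFreqShift_coe z f] with t ht
  rw [ht]
  simp only [RCLike.inner_apply, map_mul, smul_eq_mul, ← Complex.exp_conj]
  rw [real_inner_comm]
  have he : (starRingEnd ℂ 2 * starRingEnd ℂ (Real.pi : ℂ) * starRingEnd ℂ Complex.I
      * starRingEnd ℂ ((inner ℝ t z.2 : ℝ) : ℂ))
      = ((-2 * Real.pi * inner ℝ t z.2 : ℝ) : ℂ) * Complex.I := by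
    rw [Complex.conj_I, Complex.conj_ofReal, Complex.conj_ofReal, map_ofNat]
    push_cast
    ring
  rw [he]
  ring

theorem continuous_inner_timeFreqShift {d : ℕ} (f ψ : L2 d) :
    Continuous fun z : Phase d => inner ℂ (timeFreqShift z f) ψ := by
  simp_rw [← ContinuousLinearMap.adjoint_inner_right]
  exact continuous_const.inner (continuous_adjoint_timeFreqShift ψ)

/-- Moyal's identity, from Plancherel's theorem in the frequency variable and translation
invariance in the position variable. -/
theorem lintegral_enorm_inner_timeFreqShift_sq {d : ℕ} (f ψ : L2 d) :
    ∫⁻ z : Phase d, ‖inner ℂ (timeFreqShift z f) ψ‖ₑ ^ 2 = ‖f‖ₑ ^ 2 * ‖ψ‖ₑ ^ 2 := by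
  let g : Conf d → Conf d → ℂ := fun x t => inner ℂ (f (t - x)) (ψ t)
  have hg (x) : Integrable (g x) :=
    (L2.integrable_inner (translation x f) ψ).congr (by
      filter_upwards [translation_coe x f] with t ht
      rw [ht])
  have hfm : AEMeasurable (fun p : Conf d × Conf d => ‖f (p.2 - p.1)‖ₑ ^ 2) (volume.prod volume) :=
    (((Lp.aestronglyMeasurable f).comp_quasiMeasurePreserving
      ((quasiMeasurePreserving_sub_of_right_invariant volume volume).comp
        Measure.measurePreserving_swap.quasiMeasurePreserving)).enorm.pow_const 2)
  have hint : ∫⁻ x, ∫⁻ t, ‖g x t‖ₑ ^ 2 = ‖f‖ₑ ^ 2 * ‖ψ‖ₑ ^ 2 := by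
    calc ∫⁻ x, ∫⁻ t, ‖g x t‖ₑ ^ 2
       = ∫⁻ x : Conf d, ∫⁻ t, ‖f (t - x)‖ₑ ^ 2 * ‖ψ t‖ₑ ^ 2 := by
          simp [g, enorm_mul, mul_pow, mul_comm]
      _ = ∫⁻ t, ∫⁻ x : Conf d, ‖f (t - x)‖ₑ ^ 2 * ‖ψ t‖ₑ ^ 2 := by
          refine lintegral_lintegral_swap ?_
          exact hfm.mul ((Lp.aestronglyMeasurable ψ).enorm.pow_const 2).comp_snd
      _ = ∫⁻ t, ‖f‖ₑ ^ 2 * ‖ψ t‖ₑ ^ 2 := by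
          refine lintegral_congr fun t => ?_
          rw [lintegral_mul_const' _ _ (by finiteness),
            lintegral_sub_left_eq_self (fun s => ‖f s‖ₑ ^ 2) t, lintegral_enorm_sq]
      _ = _ := by rw [lintegral_const_mul' _ _ (by finiteness), lintegral_enorm_sq]
  -- `g x` is always integrable, but square integrable only for almost every `x`.
  have hae : ∀ᵐ x, MemLp (g x) 2 := by
    have hm : AEMeasurable fun x => ∫⁻ t, ‖g x t‖ₑ ^ 2 := by
      have hgm : AEMeasurable (fun p : Conf d × Conf d => ‖g p.1 p.2‖ₑ ^ 2)
          (volume.prod volume) := by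
        have := hfm.mul ((Lp.aestronglyMeasurable ψ).enorm.pow_const 2).comp_snd
        refine this.congr (Eventually.of_forall fun p => ?_)
        simp [g, enorm_mul, mul_pow, mul_comm]
      exact hgm.lintegral_prod_right'
    have hlt : ∫⁻ x, ∫⁻ t, ‖g x t‖ₑ ^ 2 ≠ ⊤ := by
      rw [hint]
      finiteness
    filter_upwards [ae_lt_top' hm hlt] with x hx
    refine ⟨(hg x).aestronglyMeasurable, ?_⟩
    rw [eLpNorm_lt_top_iff_lintegral_rpow_enorm_lt_top (by norm_num) (by norm_num)]
    simpa using hx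
  have hm : Measurable fun z : Phase d => ‖(inner ℂ (timeFreqShift z f) ψ : ℂ)‖ₑ ^ 2 :=
    (continuous_inner_timeFreqShift f ψ).measurable.enorm.pow_const 2
  rw [Measure.volume_eq_prod, lintegral_prod _ hm.aemeasurable, ← hint]
  refine lintegral_congr_ae ?_
  filter_upwards [hae] with x hx
  rw [← lintegral_enorm_fourier_sq (hg x) hx]
  simp_rw [inner_timeFreqShift_eq_fourier]
  rfl

/-! ### Time-frequency shifts and the Cohen class -/

theorem expChar_add_left {d : ℕ} (ω ω' t : Conf d) :
    expChar (ω + ω') t = expChar ω t * expChar ω' t := by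
  rw [expChar, expChar, expChar, ← Complex.exp_add, inner_add_left]
  push_cast
  ring_nf

theorem expChar_add_right {d : ℕ} (ω t t' : Conf d) :
    expChar ω (t + t') = expChar ω t * expChar ω t' := by
  rw [expChar, expChar, expChar, ← Complex.exp_add, inner_add_right]
  push_cast
  ring_nf

theorem expChar_neg {d : ℕ} (ω t : Conf d) : expChar (-ω) t = expChar ω (-t) := by
  rw [expChar, expChar, inner_neg_left, inner_neg_right]

theorem adjoint_timeFreqShift_coe {d : ℕ} (z : Phase d) (ψ : L2 d) :
    ContinuousLinearMap.adjoint (timeFreqShift z) ψ =ᵐ[volume]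
      fun t => expChar (-z.2) (t + z.1) * ψ (t + z.1) := by
  rw [adjoint_timeFreqShift_apply]
  have h := (measurePreserving_sub_right (volume : Measure (Conf d))
    (-z.1)).quasiMeasurePreserving.ae (modulation_coe (-z.2) ψ)
  filter_upwards [translation_coe (-z.1) (modulation (-z.2) ψ), h] with t h1 h2
  rw [h1, h2, sub_neg_eq_add]

/-- The commutation relation: `π(z)* π(w)` is `π(w - z)` up to a phase. -/
theorem adjoint_timeFreqShift_comp {d : ℕ} (z w : Phase d) (f : L2 d) :
    ContinuousLinearMap.adjoint (timeFreqShift z) (timeFreqShift w f)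
      = expChar (w.2 - z.2) z.1 • timeFreqShift (w - z) f := by
  ext1
  have h := (measurePreserving_add_right (volume : Measure (Conf d))
    z.1).quasiMeasurePreserving.ae (timeFreqShift_coe w f)
  filter_upwards [adjoint_timeFreqShift_coe z (timeFreqShift w f), h, timeFreqShift_coe (w - z) f,
    Lp.coeFn_smul (expChar (w.2 - z.2) z.1) (timeFreqShift (w - z) f)] with t h1 h2 h3 h4
  rw [h1, h2, h4, Pi.smul_apply, h3, smul_eq_mul]
  change expChar (-z.2) (t + z.1) * (expChar w.2 (t + z.1) * f (t + z.1 - w.1))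
    = expChar (w.2 - z.2) z.1 * (expChar (w.2 - z.2) t * f (t - (w.1 - z.1)))
  rw [← mul_assoc, ← mul_assoc, ← expChar_add_left, ← expChar_add_right]
  have h5 : t + z.1 - w.1 = t - (w.1 - z.1) := by abel
  rw [h5, neg_add_eq_sub, add_comm t]

theorem enorm_inner_timeFreqShift_timeFreqShift {d : ℕ} (z w : Phase d) (f g : L2 d) :
    ‖inner ℂ (timeFreqShift w f) (timeFreqShift z g)‖ₑ
      = ‖inner ℂ (timeFreqShift (w - z) f) g‖ₑ := by
  rw [← ContinuousLinearMap.adjoint_inner_left, adjoint_timeFreqShift_comp, inner_smul_left,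
    enorm_mul]
  have h : ‖(starRingEnd ℂ) (expChar (w.2 - z.2) z.1)‖ₑ = 1 := by
    rw [← ofReal_norm, RCLike.norm_conj, norm_expChar, ENNReal.ofReal_one]
  rw [h, one_mul]

theorem enorm_timeFreqShift {d : ℕ} (z : Phase d) (f : L2 d) : ‖timeFreqShift z f‖ₑ = ‖f‖ₑ := by
  have h : ‖timeFreqShift z f‖ = ‖f‖ :=
    LinearIsometry.norm_map ((modulation z.2).comp (translation z.1)) f
  rw [← ofReal_norm, h, ofReal_norm]

theorem inner_parity_left {d : ℕ} (φ ψ : L2 d) :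
    inner ℂ (parity d φ) ψ = inner ℂ φ (parity d ψ) := by
  have h : parity d (parity d φ) = φ := by
    ext1
    have h := (Measure.measurePreserving_neg
      (volume : Measure (Conf d))).quasiMeasurePreserving.ae (parity_coe φ)
    filter_upwards [parity_coe (parity d φ), h] with t h1 h2
    rw [h1, h2, neg_neg]
  conv_rhs => rw [← h]
  exact (LinearIsometry.inner_map_map (𝕜 := ℂ) (E := L2 d) (E' := L2 d)
    (Lp.compMeasurePreservingₗᵢ ℂ (fun t : Conf d => -t)
      (Measure.measurePreserving_neg volume)) _ _).symm

/-- `P π(z) P = π(-z)`, which is `π(z)*` up to a phase. -/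
theorem adjoint_timeFreqShift_eq_parity {d : ℕ} (z : Phase d) (ψ : L2 d) :
    ContinuousLinearMap.adjoint (timeFreqShift z) ψ
      = expChar (-z.2) z.1 • parity d (timeFreqShift z (parity d ψ)) := by
  ext1
  have hP := (Measure.measurePreserving_neg (volume : Measure (Conf d))).quasiMeasurePreserving
  have h1 := hP.ae (timeFreqShift_coe z (parity d ψ))
  have h2 := (hP.comp (measurePreserving_add_right volume z.1).quasiMeasurePreserving).ae
    (parity_coe ψ)
  filter_upwards [adjoint_timeFreqShift_coe z ψ, h1, h2,
    parity_coe (timeFreqShift z (parity d ψ)),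
    Lp.coeFn_smul (expChar (-z.2) z.1) (parity d (timeFreqShift z (parity d ψ)))]
    with t h3 h1 h2 h4 h5
  have h6 : (-t - z.1 : Conf d) = ((fun t => -t) ∘ fun t => t + z.1) t := by
    simp only [Function.comp_apply]
    abel
  rw [h3, h5, Pi.smul_apply, h4, h1, smul_eq_mul, h6, h2]
  change _ = expChar (-z.2) z.1 * (expChar z.2 (-t) * _)
  rw [← mul_assoc, ← expChar_neg, ← expChar_add_right]
  simp [add_comm]

/-- `Q_S(ψ)(z) = ⟨α_z(S) ψ, ψ⟩`: the two parity conjugations in the definition of `Q_S` turn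
`π(z)` into `π(z)*`. -/
theorem cohen_eq_inner {d : ℕ} (S : L2 d →L[ℂ] L2 d) (ψ : L2 d) (z : Phase d) :
    cohen S ψ z = inner ℂ ψ (opTranslate z S ψ) := by
  set v := timeFreqShift z (parity d ψ) with hv
  have h1 (e : L2 d) : (opCheck S ∘L opTranslate z (opCheck (InnerProductSpace.rankOne ℂ ψ ψ))) e
      = (inner ℂ v e : ℂ) • opCheck S v := by
    rw [ContinuousLinearMap.comp_apply, ← map_smul]
    congr 1
    simp only [opTranslate, opCheck, ContinuousLinearMap.comp_apply,
      InnerProductSpace.rankOne_apply, map_smul, ← hv]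
    rw [← inner_parity_left, ContinuousLinearMap.adjoint_inner_right]
  rw [cohen, opConv, opTrace]
  simp_rw [h1, inner_smul_right]
  rw [(basis d).tsum_inner_mul_inner, inner_opTranslate, adjoint_timeFreqShift_eq_parity, ← hv,
    map_smul, inner_smul_left, inner_smul_right, ← mul_assoc, Complex.conj_mul', norm_expChar,
    inner_parity_left]
  simp [opCheck]

/-! ### Rank-one decomposition of a density operator -/

/-- The positive square root, stated on a general Hilbert space, where the instances of the
continuous functional calculus are found. -/
theorem exists_symmetric_sqrt {H : Type*} [NormedAddCommGroup H] [InnerProductSpace ℂ H]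
    [CompleteSpace H] {S : H →L[ℂ] H} (hS : S.IsPositive) :
    ∃ T : H →L[ℂ] H, (∀ φ ψ, inner ℂ (T φ) ψ = inner ℂ φ (T ψ)) ∧
      ∀ ψ, inner ℂ ψ (S ψ) = ((‖T ψ‖ ^ 2 : ℝ) : ℂ) := by
  have hT : ContinuousLinearMap.adjoint (CFC.sqrt S) = CFC.sqrt S :=
    (CFC.sqrt_nonneg S).isSelfAdjoint
  have hsym (φ ψ : H) : inner ℂ (CFC.sqrt S φ) ψ = inner ℂ φ (CFC.sqrt S ψ) := by
    rw [← ContinuousLinearMap.adjoint_inner_right, hT]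
  refine ⟨CFC.sqrt S, hsym, fun ψ => ?_⟩
  have h : S ψ = CFC.sqrt S (CFC.sqrt S ψ) :=
    congrArg (fun T : H →L[ℂ] H => T ψ)
      (CFC.sqrt_mul_sqrt_self S ((ContinuousLinearMap.nonneg_iff_isPositive S).2 hS)).symm
  rw [h, ← hsym, inner_self_eq_norm_sq_to_K]
  norm_cast

/-- A density operator is `∑ᵢ fᵢ ⊗ fᵢ` with `∑ᵢ ‖fᵢ‖² = 1`: take `fᵢ = S^{1/2} eᵢ` for an
orthonormal basis `eᵢ`. The `fᵢ` need not be orthogonal. -/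
theorem IsDensityOperator.exists_decomposition {d : ℕ} {S : L2 d →L[ℂ] L2 d}
    (hS : IsDensityOperator S) :
    ∃ f : basisIndex d → L2 d, ∑' i, ‖f i‖ₑ ^ 2 = 1 ∧
      ∀ ψ, ENNReal.ofReal (inner ℂ ψ (S ψ)).re = ∑' i, ‖(inner ℂ (f i) ψ : ℂ)‖ₑ ^ 2 := by
  obtain ⟨T, hsym, hT⟩ := exists_symmetric_sqrt hS.isPositive
  refine ⟨fun i => T (basis d i), ?_, fun ψ => ?_⟩
  · have h := hS.trace_eq_one
    rw [opTrace] at h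
    simp_rw [hT] at h
    rw [← Complex.ofReal_tsum] at h
    norm_cast at h
    -- A divergent series would have the junk sum `0`, while the trace is `1`.
    have hs : Summable fun i => ‖T (basis d i)‖ ^ 2 := by
      by_contra hs
      rw [tsum_eq_zero_of_not_summable hs] at h
      exact zero_ne_one h
    have h2 := ENNReal.ofReal_tsum_of_nonneg (fun i => by positivity) hs
    rw [h, ENNReal.ofReal_one] at h2
    simpa only [ENNReal.ofReal_pow (norm_nonneg _), ofReal_norm] using h2.symm
  · simp_rw [hsym]
    rw [HilbertBasis.tsum_enorm_inner_sq, hT,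
      Complex.ofReal_re, ENNReal.ofReal_pow (norm_nonneg _), ofReal_norm]

/-! ### The Cohen class distribution of a sum of rank-one operators -/

section Density

variable {d : ℕ} {ι : Type*}

/-- The function `z ↦ ∑ᵢ |⟨π(z) fᵢ, ψ⟩|²` on phase space: the Cohen class distribution `Q_S(ψ)` of
`S = ∑ᵢ fᵢ ⊗ fᵢ`, with values in `[0, ∞]`. -/
noncomputable def cohenDensity (f : ι → L2 d) (ψ : L2 d) (z : Phase d) : ℝ≥0∞ :=
  ∑' i, ‖(inner ℂ (timeFreqShift z (f i)) ψ : ℂ)‖ₑ ^ 2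

/-- The autocorrelation `u ↦ tr(S α_u(S)) = ∑ᵢⱼ |⟨π(u) fⱼ, fᵢ⟩|²` of `S = ∑ᵢ fᵢ ⊗ fᵢ`. -/
noncomputable def autocorrelation (f : ι → L2 d) (u : Phase d) : ℝ≥0∞ :=
  ∑' i, cohenDensity f (f i) u

theorem measurable_enorm_inner_timeFreqShift_sq (f ψ : L2 d) :
    Measurable fun z : Phase d => ‖(inner ℂ (timeFreqShift z f) ψ : ℂ)‖ₑ ^ 2 :=
  (continuous_inner_timeFreqShift f ψ).measurable.enorm.pow_const 2

theorem measurable_cohenDensity [Countable ι] (f : ι → L2 d) (ψ : L2 d) :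
    Measurable (cohenDensity f ψ) :=
  Measurable.tsum fun i => measurable_enorm_inner_timeFreqShift_sq (f i) ψ

theorem measurable_autocorrelation [Countable ι] (f : ι → L2 d) :
    Measurable (autocorrelation f) :=
  Measurable.tsum fun i => measurable_cohenDensity f (f i)

theorem lintegral_cohenDensity [Countable ι] (f : ι → L2 d) (ψ : L2 d) :
    ∫⁻ z, cohenDensity f ψ z = (∑' i, ‖f i‖ₑ ^ 2) * ‖ψ‖ₑ ^ 2 := by
  simp_rw [cohenDensity]
  rw [lintegral_tsum fun i => (measurable_enorm_inner_timeFreqShift_sq (f i) ψ).aemeasurable,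
    ← ENNReal.tsum_mul_right]
  simp_rw [lintegral_enorm_inner_timeFreqShift_sq]

theorem lintegral_autocorrelation [Countable ι] (f : ι → L2 d) :
    ∫⁻ u, autocorrelation f u = (∑' i, ‖f i‖ₑ ^ 2) * ∑' i, ‖f i‖ₑ ^ 2 := by
  simp_rw [autocorrelation]
  rw [lintegral_tsum fun i => (measurable_cohenDensity f (f i)).aemeasurable,
    ← ENNReal.tsum_mul_left]
  simp_rw [lintegral_cohenDensity]

/-- Covariance: a time-frequency shift of `ψ` translates its distribution. -/
theorem cohenDensity_timeFreqShift (f : ι → L2 d) (ψ : L2 d) (z w : Phase d) :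
    cohenDensity f (timeFreqShift z ψ) w = cohenDensity f ψ (w - z) := by
  simp_rw [cohenDensity, enorm_inner_timeFreqShift_timeFreqShift]

/-- By Bessel's inequality the distributions of orthonormal vectors add up to at most `tr S`. -/
theorem sum_cohenDensity_le (f : ι → L2 d) {κ : Type*} {h : κ → L2 d} (hh : Orthonormal ℂ h)
    (s : Finset κ) (z : Phase d) :
    ∑ k ∈ s, cohenDensity f (h k) z ≤ ∑' i, ‖f i‖ₑ ^ 2 := by
  simp_rw [cohenDensity]
  rw [← Summable.tsum_finsetSum fun _ _ => ENNReal.summable]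
  refine ENNReal.tsum_le_tsum fun i => ?_
  rw [← enorm_timeFreqShift z (f i)]
  refine le_trans (le_of_eq ?_) (hh.sum_enorm_inner_sq_le s _)
  refine Finset.sum_congr rfl fun k _ => ?_
  rw [← inner_conj_symm, RCLike.enorm_conj]

/-- The distributions of an orthonormal basis add up to `tr S`, at every point. -/
theorem tsum_cohenDensity_hilbertBasis (f : ι → L2 d) {κ : Type*} (b : HilbertBasis κ ℂ (L2 d))
    (z : Phase d) : ∑' k, cohenDensity f (b k) z = ∑' i, ‖f i‖ₑ ^ 2 := by
  simp_rw [cohenDensity]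
  rw [ENNReal.tsum_comm]
  refine tsum_congr fun i => ?_
  rw [← enorm_timeFreqShift z (f i), ← b.tsum_enorm_inner_sq]
  refine tsum_congr fun k => ?_
  rw [← inner_conj_symm, RCLike.enorm_conj]

theorem ofReal_inner_opTranslate {S : L2 d →L[ℂ] L2 d} {f : ι → L2 d}
    (hf : ∀ ψ, ENNReal.ofReal (inner ℂ ψ (S ψ)).re = ∑' i, ‖(inner ℂ (f i) ψ : ℂ)‖ₑ ^ 2)
    (ψ : L2 d) (z : Phase d) :
    ENNReal.ofReal (inner ℂ ψ (opTranslate z S ψ)).re = cohenDensity f ψ z := by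
  rw [inner_opTranslate, hf, cohenDensity]
  simp_rw [ContinuousLinearMap.adjoint_inner_right]

theorem inner_opTranslate_eq_ofReal_re {S : L2 d →L[ℂ] L2 d} (hS : S.IsPositive) (ψ : L2 d)
    (z : Phase d) : 0 ≤ (inner ℂ ψ (opTranslate z S ψ)).re ∧
      inner ℂ ψ (opTranslate z S ψ) = (((inner ℂ ψ (opTranslate z S ψ)).re : ℝ) : ℂ) := by
  rw [inner_opTranslate]
  have h := hS.inner_nonneg_right (ContinuousLinearMap.adjoint (timeFreqShift z) ψ)
  rw [RCLike.nonneg_iff] at h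
  exact ⟨h.1, Complex.ext rfl (by simpa using h.2)⟩

theorem cohen_eq_toReal_cohenDensity {S : L2 d →L[ℂ] L2 d} (hS : S.IsPositive) {f : ι → L2 d}
    (hf : ∀ ψ, ENNReal.ofReal (inner ℂ ψ (S ψ)).re = ∑' i, ‖(inner ℂ (f i) ψ : ℂ)‖ₑ ^ 2)
    (ψ : L2 d) (z : Phase d) : cohen S ψ z = ((cohenDensity f ψ z).toReal : ℂ) := by
  obtain ⟨h1, h2⟩ := inner_opTranslate_eq_ofReal_re hS ψ z
  rw [cohen_eq_inner, ← ofReal_inner_opTranslate hf, ENNReal.toReal_ofReal h1]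
  exact h2

end Density

/-! ### Spectral identities for the localization operator -/

instance countable_basisIndex (d : ℕ) : Countable (basisIndex d) :=
  have : Fact ((2 : ℝ≥0∞) ≠ ⊤) := ⟨by norm_num⟩
  (basis d).orthonormal.countable

instance isAddHaarMeasure_volume_phase (d : ℕ) : (volume : Measure (Phase d)).IsAddHaarMeasure :=
  Measure.prod.instIsAddHaarMeasure volume volume

section Spectral

variable {d : ℕ} {ι : Type*}

/-- The eigenvalues decrease, and tend to `0` because the series converges in operator norm. -/
theorem IsSpectralRep.nonneg {A : L2 d →L[ℂ] L2 d} {lam : ℕ → ℝ} {h : ℕ → L2 d}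
    (hA : IsSpectralRep A lam h) (k : ℕ) : 0 ≤ lam k := by
  have h1 := hA.hasSum.summable.tendsto_atTop_zero.norm
  have h2 : Tendsto lam atTop (𝓝 0) := by
    rw [tendsto_zero_iff_abs_tendsto_zero]
    refine h1.congr (fun k => ?_) |>.trans (by simp)
    rw [norm_smul, InnerProductSpace.norm_rankOne, hA.orthonormal.1 k]
    simp
  exact hA.antitone.le_of_tendsto h2 k

theorem IsSpectralRep.ofReal_inner {A : L2 d →L[ℂ] L2 d} {lam : ℕ → ℝ} {h : ℕ → L2 d}
    (hA : IsSpectralRep A lam h) (ψ : L2 d) :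
    ENNReal.ofReal (inner ℂ ψ (A ψ)).re
      = ∑' k, ENNReal.ofReal (lam k) * ‖(inner ℂ (h k) ψ : ℂ)‖ₑ ^ 2 := by
  have h1 : HasSum (fun k => lam k * ‖(inner ℂ (h k) ψ : ℂ)‖ ^ 2) (inner ℂ ψ (A ψ)).re := by
    have := hA.hasSum.mapL
      (Complex.reCLM ∘L ((innerSL ℂ ψ).restrictScalars ℝ) ∘L
        ((ContinuousLinearMap.apply ℂ (L2 d) ψ).restrictScalars ℝ))
    convert this using 2 with k
    on_goal 2 => rfl
    change _ = (inner ℂ ψ (((lam k : ℂ) • InnerProductSpace.rankOne ℂ (h k) (h k)) ψ)).re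
    rw [smul_apply, InnerProductSpace.rankOne_apply, inner_smul_right,
      inner_smul_right, ← inner_conj_symm ψ (h k), Complex.mul_conj', ← Complex.ofReal_pow,
      ← Complex.ofReal_mul, Complex.ofReal_re]
  rw [← h1.tsum_eq, ENNReal.ofReal_tsum_of_nonneg
    (fun k => mul_nonneg (hA.nonneg k) (by positivity)) h1.summable]
  refine tsum_congr fun k => ?_
  rw [ENNReal.ofReal_mul (hA.nonneg k), ENNReal.ofReal_pow (norm_nonneg _), ofReal_norm]

/-- The quadratic form of `χ_Ω ⋆ S` integrates the Cohen class distribution over `Ω`. -/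
theorem ofReal_inner_locOp {S : L2 d →L[ℂ] L2 d} (hS : S.IsPositive) {f : ι → L2 d}
    (hf : ∀ ψ, ENNReal.ofReal (inner ℂ ψ (S ψ)).re = ∑' i, ‖(inner ℂ (f i) ψ : ℂ)‖ₑ ^ 2)
    {Ω : Set (Phase d)} (hΩ : IsCompact Ω) (ψ : L2 d) :
    ENNReal.ofReal (inner ℂ ψ (locOp S Ω ψ)).re = ∫⁻ z in Ω, cohenDensity f ψ z := by
  have h1 : inner ℂ ψ (locOp S Ω ψ) = ∫ z in Ω, inner ℂ ψ (opTranslate z S ψ) := by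
    rw [locOp, funOpConv_spec (integrable_charFun hΩ) S ψ ψ, ← integral_indicator hΩ.measurableSet]
    refine integral_congr_ae (Eventually.of_forall fun z => ?_)
    by_cases hz : z ∈ Ω <;> simp [charFun, hz]
  have hint : IntegrableOn (fun z => inner ℂ ψ (opTranslate z S ψ)) Ω :=
    (continuous_inner_opTranslate S ψ ψ).continuousOn.integrableOn_compact hΩ
  have h2 : (inner ℂ ψ (locOp S Ω ψ)).re = ∫ z in Ω, (inner ℂ ψ (opTranslate z S ψ)).re := by
    rw [h1]
    exact (integral_re hint).symm
  have h3 := ofReal_integral_eq_lintegral_ofReal hint.re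
    (Eventually.of_forall fun z => (inner_opTranslate_eq_ofReal_re hS ψ z).1)
  refine (congrArg ENNReal.ofReal h2).trans (h3.trans ?_)
  exact lintegral_congr fun z => ofReal_inner_opTranslate hf ψ z

variable {f : ι → L2 d} {Ω : Set (Phase d)} {l : ℕ → ℝ≥0∞} {h : ℕ → L2 d}

/-- Here and below `l` and `h` are the eigenvalues and eigenvectors of the localization operator of
`Ω`, which enters only through its quadratic form in the hypothesis `hl`. -/
theorem setLIntegral_cohenDensity_eigenvector (hh : Orthonormal ℂ h)
    (hl : ∀ ψ, ∫⁻ z in Ω, cohenDensity f ψ z = ∑' k, l k * ‖(inner ℂ (h k) ψ : ℂ)‖ₑ ^ 2) (k : ℕ) :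
    ∫⁻ z in Ω, cohenDensity f (h k) z = l k := by
  rw [hl, tsum_eq_single k fun j hj => by simp [hh.2 hj]]
  simp [← ofReal_norm, inner_self_eq_norm_sq_to_K, hh.1 k]

variable [Countable ι]

/-- The trace of the localization operator is the measure of the domain. -/
theorem tsum_eigenvalue (hf : ∑' i, ‖f i‖ₑ ^ 2 = 1) (hh : Orthonormal ℂ h)
    (hl : ∀ ψ, ∫⁻ z in Ω, cohenDensity f ψ z = ∑' k, l k * ‖(inner ℂ (h k) ψ : ℂ)‖ₑ ^ 2) :
    ∑' k, l k = volume Ω := by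
  calc ∑' k, l k = ∑' k, ∑' i, l k * ‖(inner ℂ (basis d i) (h k) : ℂ)‖ₑ ^ 2 := by
        refine tsum_congr fun k => ?_
        rw [ENNReal.tsum_mul_left, HilbertBasis.tsum_enorm_inner_sq, ← ofReal_norm, hh.1 k]
        simp
    _ = ∑' i, ∑' k, l k * ‖(inner ℂ (h k) (basis d i) : ℂ)‖ₑ ^ 2 := by
        rw [ENNReal.tsum_comm]
        refine tsum_congr fun i => tsum_congr fun k => ?_
        rw [← inner_conj_symm, RCLike.enorm_conj]
    _ = ∑' i, ∫⁻ z in Ω, cohenDensity f (basis d i) z := by simp_rw [hl]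
    _ = ∫⁻ z in Ω, 1 := by
        rw [← lintegral_tsum fun i => (measurable_cohenDensity f _).aemeasurable]
        simp_rw [tsum_cohenDensity_hilbertBasis, hf]
    _ = volume Ω := setLIntegral_one Ω

/-- The trace of the square of the localization operator. -/
theorem tsum_eigenvalue_sq (hh : Orthonormal ℂ h)
    (hl : ∀ ψ, ∫⁻ z in Ω, cohenDensity f ψ z = ∑' k, l k * ‖(inner ℂ (h k) ψ : ℂ)‖ₑ ^ 2) :
    ∑' k, l k ^ 2 = ∫⁻ z in Ω, ∫⁻ w in Ω, autocorrelation f (w - z) := by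
  calc ∑' k, l k ^ 2 = ∑' k, ∫⁻ z in Ω, l k * cohenDensity f (h k) z := by
        refine tsum_congr fun k => ?_
        rw [lintegral_const_mul _ (measurable_cohenDensity f _),
          setLIntegral_cohenDensity_eigenvector hh hl, sq]
    _ = ∫⁻ z in Ω, ∑' k, l k * cohenDensity f (h k) z :=
        (lintegral_tsum fun k => ((measurable_cohenDensity f _).const_mul _).aemeasurable).symm
    _ = ∫⁻ z in Ω, ∑' i, ∫⁻ w in Ω, cohenDensity f (timeFreqShift z (f i)) w := by
        refine lintegral_congr fun z => ?_
        simp_rw [hl, cohenDensity, ← ENNReal.tsum_mul_left]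
        rw [ENNReal.tsum_comm]
        refine tsum_congr fun i => tsum_congr fun k => ?_
        rw [← inner_conj_symm, RCLike.enorm_conj]
    _ = _ := by
        refine lintegral_congr fun z => ?_
        rw [← lintegral_tsum fun i => (measurable_cohenDensity f _).aemeasurable]
        simp_rw [cohenDensity_timeFreqShift]
        rfl

/-- `tr A - tr A²` for the localization operator `A` of `Ω`: the autocorrelation mass that is
carried from `Ω` to its complement. -/
noncomputable def leakage (f : ι → L2 d) (Ω : Set (Phase d)) : ℝ≥0∞ :=
  ∫⁻ z in Ω, ∫⁻ w in Ωᶜ, autocorrelation f (w - z)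

theorem tsum_eigenvalue_sq_add_leakage (hf : ∑' i, ‖f i‖ₑ ^ 2 = 1) (hh : Orthonormal ℂ h)
    (hΩ : MeasurableSet Ω)
    (hl : ∀ ψ, ∫⁻ z in Ω, cohenDensity f ψ z = ∑' k, l k * ‖(inner ℂ (h k) ψ : ℂ)‖ₑ ^ 2) :
    ∑' k, l k ^ 2 + leakage f Ω = volume Ω := by
  have hm : Measurable fun p : Phase d × Phase d => autocorrelation f (p.2 - p.1) :=
    (measurable_autocorrelation f).comp (measurable_snd.sub measurable_fst)
  rw [tsum_eigenvalue_sq hh hl, leakage, ← lintegral_add_left hm.lintegral_prod_right',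
    ← setLIntegral_one]
  refine lintegral_congr fun z => ?_
  rw [lintegral_add_compl _ hΩ, lintegral_sub_right_eq_self (autocorrelation f) z,
    lintegral_autocorrelation, hf, one_mul]

end Spectral

/-! ### The tail of the eigenvalue sequence -/

/-- Writing `μ = lam N`, the terms of `∑ₖ lamₖ (1 - lamₖ)` are at least `μ (1 - lamₖ)` for `k < N`
and at least `(1 - μ) lamₖ` for `k ≥ N`; these lower bounds add up to `T + μ (N - V) ≥ T`, where
`T` is the tail. -/
theorem _root_.Antitone.sub_sum_range_le {lam : ℕ → ℝ} (hanti : Antitone lam)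
    (h0 : ∀ k, 0 ≤ lam k) (h1 : ∀ k, lam k ≤ 1) {V W : ℝ} (hV : HasSum lam V)
    (hW : HasSum (fun k => lam k ^ 2) W) {N : ℕ} (hN : V ≤ N) :
    V - ∑ k ∈ Finset.range N, lam k ≤ V - W := by
  have hT : HasSum (fun k => lam (k + N)) (V - ∑ k ∈ Finset.range N, lam k) :=
    (hasSum_nat_add_iff' N).2 hV
  have hU : HasSum (fun k => lam (k + N) - lam (k + N) ^ 2)
      (V - W - ∑ k ∈ Finset.range N, (lam k - lam k ^ 2)) :=
    (hasSum_nat_add_iff' (f := fun k => lam k - lam k ^ 2) N).2 (hV.sub hW)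
  have htail := hasSum_le (fun k => ?_) (hT.mul_left (1 - lam N)) hU
  · have hhead : ∑ k ∈ Finset.range N, lam N * (1 - lam k)
        ≤ ∑ k ∈ Finset.range N, (lam k - lam k ^ 2) := by
      refine Finset.sum_le_sum fun k hk => ?_
      have := hanti (Finset.mem_range.1 hk).le
      nlinarith [h1 k]
    rw [← Finset.mul_sum, Finset.sum_sub_distrib] at hhead
    simp only [Finset.sum_const, Finset.card_range, nsmul_eq_mul, mul_one] at hhead
    nlinarith [mul_nonneg (h0 N) (sub_nonneg.2 hN)]
  · have := hanti (Nat.le_add_left N k)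
    nlinarith [h0 (k + N)]

/-- For a decreasing sequence in `[0, 1]` with sum `V ≤ N`, the terms from the `N`-th on add up to
at most `D = ∑ₖ lₖ (1 - lₖ)`. -/
theorem le_sum_range_add {l : ℕ → ℝ≥0∞} (hanti : Antitone l) (h1 : ∀ k, l k ≤ 1) {V D : ℝ≥0∞}
    (hV : ∑' k, l k = V) (hD : ∑' k, l k ^ 2 + D = V) {N : ℕ} (hVN : V ≤ N) :
    V ≤ ∑ k ∈ Finset.range N, l k + D := by
  have hVtop : V ≠ ⊤ := ne_top_of_le_ne_top (ENNReal.natCast_ne_top N) hVN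
  have hl (k) : l k ≠ ⊤ := ne_top_of_le_ne_top ENNReal.one_ne_top (h1 k)
  have hDtop : D ≠ ⊤ := ne_top_of_le_ne_top hVtop (hD ▸ le_add_self)
  have hWtop : ∑' k, l k ^ 2 ≠ ⊤ := ne_top_of_le_ne_top hVtop (hD ▸ le_self_add)
  have hsV : HasSum (fun k => (l k).toReal) V.toReal := by
    rw [← hV, ENNReal.tsum_toReal_eq hl]
    exact (ENNReal.summable_toReal (hV ▸ hVtop)).hasSum
  have hsW : HasSum (fun k => (l k).toReal ^ 2) (∑' k, l k ^ 2).toReal := by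
    simp_rw [← ENNReal.toReal_pow]
    rw [ENNReal.tsum_toReal_eq fun k => ENNReal.pow_ne_top (hl k)]
    exact (ENNReal.summable_toReal hWtop).hasSum
  have key := Antitone.sub_sum_range_le
    (fun i j hij => ENNReal.toReal_mono (hl i) (hanti hij)) (fun k => ENNReal.toReal_nonneg)
    (fun k => ENNReal.toReal_mono ENNReal.one_ne_top (h1 k)) hsV hsW (N := N)
    (by simpa using ENNReal.toReal_mono (ENNReal.natCast_ne_top N) hVN)
  have hDr : (∑' k, l k ^ 2).toReal + D.toReal = V.toReal := by
    rw [← ENNReal.toReal_add hWtop hDtop, hD]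
  have hsum : ∑ k ∈ Finset.range N, l k ≠ ⊤ := ENNReal.sum_ne_top.2 fun k _ => hl k
  rw [← ENNReal.toReal_le_toReal hVtop (ENNReal.add_ne_top.2 ⟨hsum, hDtop⟩),
    ENNReal.toReal_add hsum hDtop, ENNReal.toReal_sum fun k _ => hl k]
  linarith

/-! ### The error at a fixed scale -/

section Error

variable {d : ℕ} {ι : Type*} {S : L2 d →L[ℂ] L2 d} {f : ι → L2 d}
  {Ω : Set (Phase d)} {lam : ℕ → ℝ} {h : ℕ → L2 d}

theorem accCohen_eq_toReal (hS : S.IsPositive) (hf1 : ∑' i, ‖f i‖ₑ ^ 2 = 1)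
    (hf : ∀ ψ, ENNReal.ofReal (inner ℂ ψ (S ψ)).re = ∑' i, ‖(inner ℂ (f i) ψ : ℂ)‖ₑ ^ 2)
    (hh : Orthonormal ℂ h) (z : Phase d) :
    accCohen S Ω h z
      = ((∑ k ∈ Finset.range ⌈volume.real Ω⌉₊, cohenDensity f (h k) z).toReal : ℂ) := by
  have hfin (k) : cohenDensity f (h k) z ≠ ⊤ := by
    have := sum_cohenDensity_le f hh {k} z
    rw [Finset.sum_singleton, hf1] at this
    exact ne_top_of_le_ne_top ENNReal.one_ne_top this
  rw [accCohen, ENNReal.toReal_sum fun k _ => hfin k, Complex.ofReal_sum]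
  exact Finset.sum_congr rfl fun k _ => cohen_eq_toReal_cohenDensity hS hf (h k) z

theorem continuous_accCohen (S : L2 d →L[ℂ] L2 d) (Ω : Set (Phase d)) (h : ℕ → L2 d) :
    Continuous (accCohen S Ω h) := by
  unfold accCohen
  simp_rw [cohen_eq_inner]
  exact continuous_finsetSum _ fun k _ => continuous_inner_opTranslate S (h k) (h k)

variable [Countable ι]

theorem lintegral_sum_cohenDensity (hf1 : ∑' i, ‖f i‖ₑ ^ 2 = 1) (hh : Orthonormal ℂ h) (N : ℕ) :
    ∫⁻ z, ∑ k ∈ Finset.range N, cohenDensity f (h k) z = N := by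
  rw [lintegral_finsetSum _ fun k _ => measurable_cohenDensity f (h k)]
  simp_rw [lintegral_cohenDensity, hf1, ← ofReal_norm, hh.1]
  simp

theorem integrable_accCohen (hS : S.IsPositive) (hf1 : ∑' i, ‖f i‖ₑ ^ 2 = 1)
    (hf : ∀ ψ, ENNReal.ofReal (inner ℂ ψ (S ψ)).re = ∑' i, ‖(inner ℂ (f i) ψ : ℂ)‖ₑ ^ 2)
    (hh : Orthonormal ℂ h) : Integrable (accCohen S Ω h) := by
  refine ⟨(continuous_accCohen S Ω h).aestronglyMeasurable, ?_⟩
  refine lt_of_le_of_lt (lintegral_mono fun z => ?_)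
    ((lintegral_sum_cohenDensity hf1 hh ⌈volume.real Ω⌉₊).trans_lt (ENNReal.natCast_lt_top _))
  rw [accCohen_eq_toReal hS hf1 hf hh, ← ofReal_norm, Complex.norm_real,
    Real.norm_of_nonneg ENNReal.toReal_nonneg]
  exact ENNReal.ofReal_toReal_le

/-- The `L¹` error is `2 ∑_{k ≥ N} λₖ + N - |Ω|` with `N = ⌈|Ω|⌉`, and the tail of the eigenvalues
is at most the leakage. -/
theorem lintegral_accCohen_sub_charFun_le (hS : S.IsPositive) (hf1 : ∑' i, ‖f i‖ₑ ^ 2 = 1)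
    (hf : ∀ ψ, ENNReal.ofReal (inner ℂ ψ (S ψ)).re = ∑' i, ‖(inner ℂ (f i) ψ : ℂ)‖ₑ ^ 2)
    (hΩ : IsCompact Ω) (hA : IsSpectralRep (locOp S Ω) lam h) :
    ∫⁻ z, ‖accCohen S Ω h z - charFun Ω z‖ₑ ≤ 1 + 2 * leakage f Ω := by
  have hh := hA.orthonormal
  set N := ⌈volume.real Ω⌉₊
  set l : ℕ → ℝ≥0∞ := fun k => ENNReal.ofReal (lam k)
  have hl (ψ) : ∫⁻ z in Ω, cohenDensity f ψ z
      = ∑' k, l k * ‖(inner ℂ (h k) ψ : ℂ)‖ₑ ^ 2 := by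
    rw [← ofReal_inner_locOp hS hf hΩ, hA.ofReal_inner]
  have hlk (k) := setLIntegral_cohenDensity_eigenvector hh hl k
  set ρ : Phase d → ℝ≥0∞ := fun z => ∑ k ∈ Finset.range N, cohenDensity f (h k) z with hρ
  have hρm : Measurable ρ := Finset.measurable_sum _ fun k _ => measurable_cohenDensity f (h k)
  have hρ1 (z) : ρ z ≤ 1 := (sum_cohenDensity_le f hh _ z).trans hf1.le
  have hVtop : volume Ω ≠ ⊤ := hΩ.measure_ne_top
  have hVreal : volume Ω = ENNReal.ofReal (volume.real Ω) := (ofReal_measureReal hVtop).symm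
  have hVN : volume Ω ≤ N := by
    rw [hVreal, ← ENNReal.ofReal_natCast]
    exact ENNReal.ofReal_le_ofReal (Nat.le_ceil _)
  have hNV : (N : ℝ≥0∞) ≤ volume Ω + 1 := by
    rw [hVreal, ← ENNReal.ofReal_natCast, ← ENNReal.ofReal_one,
      ← ENNReal.ofReal_add measureReal_nonneg zero_le_one]
    exact ENNReal.ofReal_le_ofReal (Nat.ceil_lt_add_one measureReal_nonneg).le
  have hl1 (k) : l k ≤ 1 := by
    rw [← hlk k]
    refine (setLIntegral_le_lintegral _ _).trans ?_
    rw [lintegral_cohenDensity, hf1, ← ofReal_norm, hh.1 k]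
    simp
  have htail := le_sum_range_add (fun i j hij => ENNReal.ofReal_le_ofReal (hA.antitone hij)) hl1
    (tsum_eigenvalue hf1 hh hl)
    (tsum_eigenvalue_sq_add_leakage hf1 hh hΩ.measurableSet hl) hVN
  have hin : ∫⁻ z in Ω, ρ z = ∑ k ∈ Finset.range N, l k := by
    rw [hρ, lintegral_finsetSum _ fun k _ => measurable_cohenDensity f (h k)]
    exact Finset.sum_congr rfl fun k _ => hlk k
  have hsumtop : ∑ k ∈ Finset.range N, l k ≠ ⊤ := ENNReal.sum_ne_top.2 fun k _ => by simp [l]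
  have ha : ∫⁻ z in Ω, (1 - ρ z) ≤ leakage f Ω := by
    rw [lintegral_sub hρm (hin ▸ hsumtop) (Eventually.of_forall hρ1), setLIntegral_one, hin]
    exact tsub_le_iff_left.2 htail
  have hb : ∫⁻ z in Ωᶜ, ρ z ≤ 1 + leakage f Ω := by
    have := lintegral_add_compl ρ hΩ.measurableSet (μ := volume)
    rw [lintegral_sum_cohenDensity hf1 hh, hin] at this
    refine (ENNReal.add_le_add_iff_left hsumtop).1 ?_
    rw [this]
    refine hNV.trans ((add_le_add_left htail 1).trans (le_of_eq ?_))
    ring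
  have hacc (z) : accCohen S Ω h z = ((ρ z).toReal : ℂ) := accCohen_eq_toReal hS hf1 hf hh z
  rw [← lintegral_add_compl _ hΩ.measurableSet]
  calc _ = (∫⁻ z in Ω, (1 - ρ z)) + ∫⁻ z in Ωᶜ, ρ z := by
        congr 1
        · refine setLIntegral_congr_fun hΩ.measurableSet fun z hz => ?_
          have hr : (ρ z).toReal ≤ 1 := by
            simpa using ENNReal.toReal_mono ENNReal.one_ne_top (hρ1 z)
          rw [hacc, charFun, Set.indicator_of_mem hz, ← ofReal_norm, ← Complex.ofReal_one,
            ← Complex.ofReal_sub, Complex.norm_real, Real.norm_eq_abs, abs_sub_comm,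
            abs_of_nonneg (sub_nonneg.2 hr), ENNReal.ofReal_sub _ ENNReal.toReal_nonneg,
            ENNReal.ofReal_one,
            ENNReal.ofReal_toReal (ne_top_of_le_ne_top ENNReal.one_ne_top (hρ1 z))]
        · refine setLIntegral_congr_fun hΩ.measurableSet.compl fun z hz => ?_
          rw [hacc, charFun, Set.indicator_of_notMem hz, sub_zero, ← ofReal_norm,
            Complex.norm_real, Real.norm_of_nonneg ENNReal.toReal_nonneg,
            ENNReal.ofReal_toReal (ne_top_of_le_ne_top ENNReal.one_ne_top (hρ1 z))]
    _ ≤ leakage f Ω + (1 + leakage f Ω) := add_le_add ha hb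
    _ = 1 + 2 * leakage f Ω := by ring

end Error

/-! ### Dilations -/

section Dilation

variable {d : ℕ}

instance isNegInvariant_volume_phase (d : ℕ) : (volume : Measure (Phase d)).IsNegInvariant :=
  Measure.IsAddHaarMeasure.isNegInvariant_of_regular volume

theorem volume_vadd_sdiff_eq_lintegral {Ω : Set (Phase d)} (hΩ : MeasurableSet Ω) (u : Phase d) :
    volume ((u +ᵥ Ω) \ Ω) = ∫⁻ w, Ω.indicator 1 (w - u) * Ωᶜ.indicator 1 w := by
  rw [← lintegral_indicator_one ((hΩ.const_vadd u).diff hΩ)]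
  refine lintegral_congr fun w => ?_
  have hw : w ∈ u +ᵥ Ω ↔ w - u ∈ Ω := by
    rw [Set.mem_vadd_set_iff_neg_vadd_mem, vadd_eq_add, neg_add_eq_sub]
  by_cases h1 : w - u ∈ Ω <;> by_cases h2 : w ∈ Ω <;> simp [h1, h2, hw, Set.indicator]

theorem measurable_volume_vadd_sdiff {Ω : Set (Phase d)} (hΩ : MeasurableSet Ω) :
    Measurable fun u : Phase d => volume ((u +ᵥ Ω) \ Ω) := by
  simp_rw [volume_vadd_sdiff_eq_lintegral hΩ]
  have hind : Measurable (Ω.indicator (1 : Phase d → ℝ≥0∞)) := measurable_one.indicator hΩ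
  have hindc : Measurable (Ωᶜ.indicator (1 : Phase d → ℝ≥0∞)) := measurable_one.indicator hΩ.compl
  have hm : Measurable fun p : Phase d × Phase d =>
      Ω.indicator (1 : Phase d → ℝ≥0∞) (p.2 - p.1) * Ωᶜ.indicator 1 p.2 := by fun_prop
  exact hm.lintegral_prod_right'

/-- The leakage as an integral over the displacement `u = w - z`. -/
theorem leakage_eq_lintegral {ι : Type*} [Countable ι] (f : ι → L2 d)
    {Ω : Set (Phase d)} (hΩ : MeasurableSet Ω) :
    leakage f Ω = ∫⁻ u, autocorrelation f u * volume ((u +ᵥ Ω) \ Ω) := by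
  have hK := measurable_autocorrelation f
  have hind : Measurable (Ω.indicator (1 : Phase d → ℝ≥0∞)) := measurable_one.indicator hΩ
  have hindc : Measurable (Ωᶜ.indicator (1 : Phase d → ℝ≥0∞)) := measurable_one.indicator hΩ.compl
  calc leakage f Ω
      = ∫⁻ z, ∫⁻ w, Ω.indicator 1 z * (Ωᶜ.indicator 1 w * autocorrelation f (w - z)) := by
        rw [leakage, ← lintegral_indicator hΩ]
        refine lintegral_congr fun z => ?_
        by_cases hz : z ∈ Ω
        · rw [Set.indicator_of_mem hz, ← lintegral_indicator hΩ.compl]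
          refine lintegral_congr fun w => ?_
          by_cases hw : w ∈ Ωᶜ <;> simp [hz, hw, Set.indicator]
        · simp [hz]
    _ = ∫⁻ w, ∫⁻ z, Ω.indicator 1 z * (Ωᶜ.indicator 1 w * autocorrelation f (w - z)) :=
        lintegral_lintegral_swap (by fun_prop)
    _ = ∫⁻ w, ∫⁻ u, Ω.indicator 1 (w - u) * (Ωᶜ.indicator 1 w * autocorrelation f u) := by
        refine lintegral_congr fun w => ?_
        rw [← lintegral_sub_left_eq_self _ w]
        simp
    _ = ∫⁻ u, ∫⁻ w, Ω.indicator 1 (w - u) * (Ωᶜ.indicator 1 w * autocorrelation f u) :=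
        lintegral_lintegral_swap (by fun_prop)
    _ = _ := by
        refine lintegral_congr fun u => ?_
        rw [volume_vadd_sdiff_eq_lintegral hΩ, ← lintegral_const_mul _ (by fun_prop)]
        refine lintegral_congr fun w => ?_
        ring

theorem volume_vadd_smul_sdiff (Ω : Set (Phase d)) {R : ℝ} (hR : 0 < R) (u : Phase d) :
    volume ((u +ᵥ R • Ω) \ (R • Ω))
      = ENNReal.ofReal (R ^ Module.finrank ℝ (Phase d)) * volume (((R⁻¹ • u) +ᵥ Ω) \ Ω) := by
  have h : (u +ᵥ R • Ω) \ (R • Ω) = R • (((R⁻¹ • u) +ᵥ Ω) \ Ω) := by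
    rw [Set.smul_set_sdiff₀ hR.ne']
    congr 1
    ext w
    simp only [Set.mem_vadd_set_iff_neg_vadd_mem, Set.mem_smul_set_iff_inv_smul_mem₀ hR.ne',
      vadd_eq_add, smul_add, smul_neg]
  rw [h, Measure.addHaar_smul_of_nonneg _ hR.le]

/-- The autocorrelation rescaled by `R` is an approximate identity, so the leakage of `RΩ` is of
smaller order than its volume. -/
theorem tendsto_leakage_smul {ι : Type*} [Countable ι] {f : ι → L2 d}
    (hf1 : ∑' i, ‖f i‖ₑ ^ 2 = 1) {Ω : Set (Phase d)} (hΩ : IsCompact Ω) :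
    Tendsto (fun R : ℝ => (ENNReal.ofReal (R ^ Module.finrank ℝ (Phase d)))⁻¹
      * leakage f (R • Ω)) atTop (𝓝 0) := by
  have hK := measurable_autocorrelation f
  have hV : volume Ω ≠ ⊤ := hΩ.measure_ne_top
  have hlim : Tendsto (fun R : ℝ => ∫⁻ u, autocorrelation f u * volume (((R⁻¹ • u) +ᵥ Ω) \ Ω))
      atTop (𝓝 (∫⁻ _ : Phase d, 0)) := by
    have hfin : ∀ᵐ u, autocorrelation f u < ⊤ := by
      refine ae_lt_top hK ?_
      rw [lintegral_autocorrelation, hf1]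
      simp
    refine tendsto_lintegral_filter_of_dominated_convergence
      (fun u => autocorrelation f u * volume Ω) ?_ ?_ ?_ ?_
    · refine Eventually.of_forall fun R => ?_
      exact (hK.mul ((measurable_volume_vadd_sdiff hΩ.measurableSet).comp
        (measurable_const_smul R⁻¹)))
    · refine Eventually.of_forall fun R => Eventually.of_forall fun u => ?_
      refine mul_le_mul_right ((measure_mono Set.sdiff_subset).trans ?_) _
      rw [measure_vadd]
    · rw [lintegral_mul_const _ hK, lintegral_autocorrelation, hf1]
      simpa using hV
    · filter_upwards [hfin] with u hu
      have h1 : Tendsto (fun R : ℝ => R⁻¹ • u) atTop (𝓝 0) := by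
        simpa using (tendsto_inv_atTop_zero (𝕜 := ℝ)).smul_const u
      have h2 := (tendsto_measure_vadd_sdiff_isCompact_isClosed (μ := volume) hΩ
        hΩ.isClosed).comp h1
      simpa using ENNReal.Tendsto.const_mul h2 (Or.inr hu.ne)
  rw [lintegral_zero] at hlim
  refine hlim.congr' ?_
  filter_upwards [eventually_gt_atTop 0] with R hR
  have hc : ENNReal.ofReal (R ^ Module.finrank ℝ (Phase d)) ≠ 0 := by
    simp only [ne_eq, ENNReal.ofReal_eq_zero, not_le]
    positivity
  rw [leakage_eq_lintegral f (hΩ.smul R).measurableSet,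
    ← lintegral_const_mul' _ _ (ENNReal.inv_ne_top.2 hc)]
  refine lintegral_congr fun u => ?_
  rw [volume_vadd_smul_sdiff Ω hR, mul_left_comm, ← mul_assoc _ _ (volume _),
    ENNReal.inv_mul_cancel hc ENNReal.ofReal_ne_top, one_mul]

theorem lintegral_comp_smul {g : Phase d → ℝ≥0∞} (hg : Measurable g) {R : ℝ} (hR : 0 < R) :
    ∫⁻ z, g (R • z) = (ENNReal.ofReal (R ^ Module.finrank ℝ (Phase d)))⁻¹ * ∫⁻ z, g z := by
  have hp := pow_pos hR (Module.finrank ℝ (Phase d))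
  rw [← lintegral_map hg (measurable_const_smul R), Measure.map_addHaar_smul _ hR.ne',
    lintegral_smul_measure, abs_of_pos (inv_pos.2 hp), ENNReal.ofReal_inv_of_pos hp, smul_eq_mul]

theorem charFun_smul (Ω : Set (Phase d)) {R : ℝ} (hR : 0 < R) (z : Phase d) :
    charFun (R • Ω) (R • z) = charFun Ω z := by
  classical
  simp only [charFun, Set.indicator_apply, Set.smul_mem_smul_set_iff₀ hR.ne']

end Dilation

end QHA


theorem mainTheorem1 (d : ℕ) (hd : 0 < d) (S : QHA.L2 d →L[ℂ] QHA.L2 d)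
    (hS : QHA.IsDensityOperator S) (Ω : Set (QHA.Phase d)) (hΩ : IsCompact Ω)
    (lam : ℝ → ℕ → ℝ) (h : ℝ → ℕ → QHA.L2 d)
    (hspec : ∀ R : ℝ, 0 < R → QHA.IsSpectralRep (QHA.locOp S (R • Ω)) (lam R) (h R)) :
    (∀ R : ℝ, 0 < R →
      MemLp (fun z : QHA.Phase d => QHA.accCohen S (R • Ω) (h R) (R • z)) 1 volume) ∧
    Tendsto (fun R : ℝ =>
      eLpNorm (fun z : QHA.Phase d =>
        QHA.accCohen S (R • Ω) (h R) (R • z) - QHA.charFun Ω z) 1 volume) atTop (𝓝 0) := by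
  obtain ⟨f, hf1, hf⟩ := hS.exists_decomposition
  refine ⟨fun R hR => ?_, ?_⟩
  · rw [memLp_one_iff_integrable]
    exact (QHA.integrable_accCohen hS.isPositive hf1 hf (hspec R hR).orthonormal).comp_smul hR.ne'
  have hn : Module.finrank ℝ (QHA.Phase d) ≠ 0 := by
    rw [Module.finrank_prod, finrank_euclideanSpace_fin]
    lia
  have hc : Tendsto (fun R : ℝ => (ENNReal.ofReal (R ^ Module.finrank ℝ (QHA.Phase d)))⁻¹)
      atTop (𝓝 0) := by
    rw [← ENNReal.inv_top]
    exact ((ENNReal.tendsto_ofReal_atTop.comp (tendsto_pow_atTop hn)).inv)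
  have hbound := hc.add (ENNReal.Tendsto.const_mul (QHA.tendsto_leakage_smul hf1 hΩ)
    (Or.inr ENNReal.ofNat_ne_top) (a := 2))
  rw [mul_zero, add_zero] at hbound
  refine tendsto_of_tendsto_of_tendsto_of_le_of_le' tendsto_const_nhds hbound
    (Eventually.of_forall fun R => zero_le) ?_
  filter_upwards [eventually_gt_atTop 0] with R hR
  have hΩR : IsCompact (R • Ω) := hΩ.smul R
  have hm : Measurable fun z =>
      ‖QHA.accCohen S (R • Ω) (h R) z - QHA.charFun (R • Ω) z‖ₑ :=
    ((QHA.continuous_accCohen S _ _).measurable.sub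
      (measurable_const.indicator hΩR.measurableSet)).enorm
  -- Undo the dilation: the error is `R⁻²ᵈ` times the one for `RΩ`, which `1 + 2 * leakage` bounds.
  rw [eLpNorm_one_eq_lintegral_enorm]
  simp_rw [← QHA.charFun_smul Ω hR]
  rw [QHA.lintegral_comp_smul hm hR]
  refine (mul_le_mul_right (QHA.lintegral_accCohen_sub_charFun_le hS.isPositive hf1 hf hΩR
    (hspec R hR)) _).trans (le_of_eq ?_)
  ring
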